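/- Let $A,B\in\mathbb Q(t)$ with $4A^3+27B^2\neq 0$, let $E/\mathbb Q(t)$ be the elliptic curve $y^2=x^3+A(t)x+B(t)$, and assume that $E$ is nonconstant, i.e. that $A$ and $B$ are not both in $\mathbb Q$. Let $n\ge 2$ be an integer and let $M\subseteq E(\mathbb Q(t))$ be a subgroup of rank at least $1$ such that 1. $M$ is finitely generated; 2. the map $M/nM\to E(\mathbb Q(t))/nE(\mathbb Q(t))$ induced by the inclusion is injective; 3. $M[n]=E(\mathbb Q(t))[n]$. For $t_0\in\mathbb Q$ such that $A$ and $B$ have no pole at $t_0$ and $4A(t_0)^3+27B(t_0)^2\ne0$, let $E_{t_0}/\mathbb Q$ be the elliptic curve $y^2=x^3+A(t_0)x+B(t_0)$, and let $\sigma_{t_0}:E(\mathbb Q(t))\to E_{t_0}(\mathbb Q)$ be the specialization map, which sends $O$ to $O$ and $(x(t),y(t))$ to $(x(t_0),y(t_0))$, read as $O$ if the coordinates have a pole at $t_0$. A Hilbert subset of $\mathbb Q$ is a set of the form $$\{t_0\in\mathbb Q : f_i(t_0,x)\in\mathbb Q[x]\text{ is irreducible for } i=1,\dots,r\},$$ where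 $f_1,\dots,f_r\in\mathbb Q[t,x]$ are finitely many irreducible polynomials, each of positive degree in $x$. Then there is a set $S_M\subseteq\mathbb Q$, differing from a Hilbert subset of $\mathbb Q$ by only finitely many elements, such that for every $t_0\in S_M$ the specialization $E_{t_0}$ is defined (as above) and $\sigma_{t_0}|_M:M\to E_{t_0}(\mathbb Q)$ is injective. -/

import Mathlib

open Polynomial

noncomputable section

/-- Decidable equality on `ℚ(t)`, needed by Mathlib's group law on points. -/
instance ratFuncDecidableEq : DecidableEq (RatFunc ℚ) := Classical.decEq _

/-- The Weierstrass curve `y² = x³ + A x + B`. -/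
def shortCurve {K : Type*} [Field K] (A B : K) : WeierstrassCurve.Affine K :=
  { a₁ := 0, a₂ := 0, a₃ := 0, a₄ := A, a₆ := B }

/-- `f ∈ ℚ(t)` has no pole at `t₀`. -/
def RegularAt (t₀ : ℚ) (f : RatFunc ℚ) : Prop := f.denom.eval t₀ ≠ 0

/-- The value `f(t₀)` (meaningful if `f` has no pole at `t₀`). -/
def valueAt (t₀ : ℚ) (f : RatFunc ℚ) : ℚ := f.eval (RingHom.id ℚ) t₀

lemma RegularAt.add {t₀ : ℚ} {f g : RatFunc ℚ} (hf : RegularAt t₀ f) (hg : RegularAt t₀ g) :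
    RegularAt t₀ (f + g) := by
  intro h
  have := eval_dvd (x := t₀) (RatFunc.denom_add_dvd f g)
  rw [h, zero_dvd_iff, eval_mul] at this
  exact mul_ne_zero hf hg this

lemma RegularAt.mul {t₀ : ℚ} {f g : RatFunc ℚ} (hf : RegularAt t₀ f) (hg : RegularAt t₀ g) :
    RegularAt t₀ (f * g) := by
  intro h
  have := eval_dvd (x := t₀) (RatFunc.denom_mul_dvd f g)
  rw [h, zero_dvd_iff, eval_mul] at this
  exact mul_ne_zero hf hg this

lemma valueAt_add {t₀ : ℚ} {f g : RatFunc ℚ} (hf : RegularAt t₀ f) (hg : RegularAt t₀ g) :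
    valueAt t₀ (f + g) = valueAt t₀ f + valueAt t₀ g :=
  RatFunc.eval_add _ _ hf hg

lemma valueAt_mul {t₀ : ℚ} {f g : RatFunc ℚ} (hf : RegularAt t₀ f) (hg : RegularAt t₀ g) :
    valueAt t₀ (f * g) = valueAt t₀ f * valueAt t₀ g :=
  RatFunc.eval_mul _ _ hf hg

lemma shortCurve_equation_iff {K : Type*} [Field K] (A B x y : K) :
    (shortCurve A B).Equation x y ↔ y * y = x * x * x + A * x + B := by
  rw [WeierstrassCurve.Affine.equation_iff]
  simp only [shortCurve]
  constructor <;> intro h <;> linear_combination h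

lemma shortCurve_nonsingular {A B x y : ℚ} (hΔ : 4 * A ^ 3 + 27 * B ^ 2 ≠ 0)
    (h : (shortCurve A B).Equation x y) : (shortCurve A B).Nonsingular x y := by
  refine (WeierstrassCurve.Affine.equation_iff_nonsingular_of_Δ_ne_zero ?_).mp h
  have : (shortCurve A B).Δ = -16 * (4 * A ^ 3 + 27 * B ^ 2) := by
    simp only [WeierstrassCurve.Δ, WeierstrassCurve.b₂, WeierstrassCurve.b₄,
      WeierstrassCurve.b₆, WeierstrassCurve.b₈, shortCurve]
    ring
  rw [this]
  exact mul_ne_zero (by norm_num) hΔ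

/-- The specialization `E_{t₀} : y² = x³ + A(t₀) x + B(t₀)` is a well-defined elliptic curve:
`A` and `B` have no pole at `t₀`, and the discriminant does not vanish there. -/
structure GoodAt (A B : RatFunc ℚ) (t₀ : ℚ) : Prop where
  regular_A : RegularAt t₀ A
  regular_B : RegularAt t₀ B
  disc_ne_zero : 4 * valueAt t₀ A ^ 3 + 27 * valueAt t₀ B ^ 2 ≠ 0

lemma GoodAt.nonsingular {A B : RatFunc ℚ} {t₀ : ℚ} (h : GoodAt A B t₀) {x y : RatFunc ℚ}
    (hxy : (shortCurve A B).Nonsingular x y) (hx : RegularAt t₀ x) (hy : RegularAt t₀ y) :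
    (shortCurve (valueAt t₀ A) (valueAt t₀ B)).Nonsingular (valueAt t₀ x) (valueAt t₀ y) := by
  refine shortCurve_nonsingular h.disc_ne_zero ?_
  rw [shortCurve_equation_iff]
  have e := congrArg (valueAt t₀) ((shortCurve_equation_iff A B x y).mp hxy.1)
  have hxx := hx.mul hx
  have hA := h.regular_A
  rwa [valueAt_mul hy hy, valueAt_add ((hxx.mul hx).add (hA.mul hx)) h.regular_B,
    valueAt_add (hxx.mul hx) (hA.mul hx), valueAt_mul hxx hx, valueAt_mul hx hx,
    valueAt_mul hA hx] at e

open Classical in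
/-- The specialization map `σ_{t₀} : E(ℚ(t)) → E_{t₀}(ℚ)`: it sends `O` to `O` and
`(x(t), y(t))` to `(x(t₀), y(t₀))`, which is read as the point at infinity `O` of `E_{t₀}` when
the coordinates have a pole at `t₀`. -/
def specialize {A B : RatFunc ℚ} {t₀ : ℚ} (h : GoodAt A B t₀) :
    (shortCurve A B).Point → (shortCurve (valueAt t₀ A) (valueAt t₀ B)).Point
  | .zero => .zero
  | .some x y hxy =>
    if hr : RegularAt t₀ x ∧ RegularAt t₀ y then
      .some (valueAt t₀ x) (valueAt t₀ y) (h.nonsingular hxy hr.1 hr.2)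
    else .zero

/-- The subgroup `nG` of an abelian group `G`. -/
def multiplesOf (n : ℕ) (G : Type*) [AddCommGroup G] : AddSubgroup G :=
  (nsmulAddMonoidHom n : G →+ G).range

lemma multiplesOf_le_comap (n : ℕ) {M N : Type*} [AddCommGroup M] [AddCommGroup N]
    (φ : M →+ N) : multiplesOf n M ≤ (multiplesOf n N).comap φ := by
  rintro _ ⟨a, rfl⟩
  exact ⟨φ a, by simp⟩

/-- The map `M/nM → N/nN` induced by a homomorphism `φ : M → N` of abelian groups. -/
def modMap (n : ℕ) {M N : Type*} [AddCommGroup M] [AddCommGroup N] (φ : M →+ N) :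
    M ⧸ multiplesOf n M →+ N ⧸ multiplesOf n N :=
  QuotientAddGroup.map _ _ φ (multiplesOf_le_comap n φ)

/-- The four conditions on a homomorphism `φ : M → N` of abelian groups, with respect to `n`:
`M` is finitely generated, `M/nM → N/nN` is injective, `φ` restricts to an isomorphism
`M[n] ≅ N[n]`, and `φ` is injective on the torsion of `M`. -/
structure DescentConditions (n : ℕ) {M N : Type*} [AddCommGroup M] [AddCommGroup N]
    (φ : M →+ N) : Prop where
  fg : AddGroup.FG M
  injective_mod : Function.Injective (modMap n φ)
  bijOn_torsion : Set.BijOn φ {a : M | n • a = 0} {b : N | n • b = 0}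
  injOn_torsion : Set.InjOn φ {a : M | IsOfFinAddOrder a}

/-- Hilbert subsets of `ℚ`. Polynomials in `ℚ[t, x]` are elements of `ℚ[t][x]`; each of the finitely
many irreducible polynomials is required to involve `x` (otherwise its specializations
are constants, never irreducible, and the empty set would be a Hilbert set). -/
def IsHilbertSet (H : Set ℚ) : Prop :=
  ∃ F : Finset ℚ[X][X], (∀ f ∈ F, Irreducible f ∧ 0 < f.natDegree) ∧
    H = {t₀ : ℚ | ∀ f ∈ F, Irreducible (f.map (evalRingHom t₀))}

end

/-! Let K be the kernel of σ = σ_{t₀} on M. Suppose that every n-th part of 0, and of each of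
finitely many representatives of M/nM, on E_{t₀}(ℚ) lifts to an n-th part over ℚ(t). Condition 2
then shows that a ∈ M is divisible by n in M as soon as σ(a) is divisible by n. So a ∈ K is nc with
c ∈ M. The n-torsion point σ(c) lifts to some z ∈ M[n] by condition 3, and a = n(c - z) with c - z ∈
K. Hence K = nK, and by Nakayama a nonzero integer kills the finitely generated group K
(`injective_of_descent`). Thus K is torsion; M has finitely many torsion points, and each nonzero
one specializes to O for only finitely many t₀.

The lifting (`eventually_lift_division`) is where Hilbert sets enter. The x-coordinate of an n-th
part of P is a root of a fixed nonzero polynomial over ℚ(t). If an irreducible factor stays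
irreducible of the same degree at t₀, a rational root there forces degree 1, so the root comes from
ℚ(t). The y-coordinate is treated in the same way.

Hilbert's irreducibility theorem is not needed: the Hilbert set is never claimed to be nonempty. -/

noncomputable section

/-! ### Values and poles of rational functions at a rational point. -/

/-- `f` is regular at `t₀` with value `a`. -/
def HasValueAt (t₀ : ℚ) (f : RatFunc ℚ) (a : ℚ) : Prop := RegularAt t₀ f ∧ valueAt t₀ f = a

namespace HasValueAt

variable {t₀ : ℚ} {f g : RatFunc ℚ} {a b : ℚ}

lemma of_regularAt (hf : RegularAt t₀ f) : HasValueAt t₀ f (valueAt t₀ f) := ⟨hf, rfl⟩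

lemma unique (hf : HasValueAt t₀ f a) (hf' : HasValueAt t₀ f b) : a = b := hf.2.symm.trans hf'.2

lemma add (hf : HasValueAt t₀ f a) (hg : HasValueAt t₀ g b) : HasValueAt t₀ (f + g) (a + b) :=
  ⟨hf.1.add hg.1, by rw [valueAt_add hf.1 hg.1, hf.2, hg.2]⟩

lemma mul (hf : HasValueAt t₀ f a) (hg : HasValueAt t₀ g b) : HasValueAt t₀ (f * g) (a * b) :=
  ⟨hf.1.mul hg.1, by rw [valueAt_mul hf.1 hg.1, hf.2, hg.2]⟩

lemma polynomial (t₀ : ℚ) (p : ℚ[X]) :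
    HasValueAt t₀ (algebraMap ℚ[X] (RatFunc ℚ) p) (p.eval t₀) := by
  constructor
  · simp [RegularAt]
  · simp [valueAt, RatFunc.eval]

lemma const (t₀ c : ℚ) : HasValueAt t₀ (RatFunc.C c) c := by
  simpa only [RatFunc.algebraMap_C, eval_C] using polynomial t₀ (C c)

lemma zero (t₀ : ℚ) : HasValueAt t₀ 0 0 := by simpa using const t₀ 0

lemma one (t₀ : ℚ) : HasValueAt t₀ 1 1 := by simpa using const t₀ 1

lemma ofNat (t₀ : ℚ) (n : ℕ) [n.AtLeastTwo] : HasValueAt t₀ (OfNat.ofNat n) (OfNat.ofNat n) := by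
  simpa using const t₀ (OfNat.ofNat n)

lemma neg (hf : HasValueAt t₀ f a) : HasValueAt t₀ (-f) (-a) := by
  simpa using (const t₀ (-1)).mul hf

lemma sub (hf : HasValueAt t₀ f a) (hg : HasValueAt t₀ g b) : HasValueAt t₀ (f - g) (a - b) := by
  simpa [sub_eq_add_neg] using hf.add hg.neg

lemma pow (hf : HasValueAt t₀ f a) (n : ℕ) : HasValueAt t₀ (f ^ n) (a ^ n) := by
  induction n with
  | zero => simpa using one t₀
  | succ n ih => simpa [pow_succ] using ih.mul hf

lemma inv (hf : HasValueAt t₀ f a) (ha : a ≠ 0) : HasValueAt t₀ f⁻¹ a⁻¹ := by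
  have hnum : f.num.eval t₀ ≠ 0 := by
    intro h
    apply ha
    rw [← hf.2]
    simp [valueAt, RatFunc.eval, eval₂_id, h]
  have hf0 : f ≠ 0 := by rintro rfl; simp at hnum
  have hreg : RegularAt t₀ f⁻¹ := by
    intro h
    have := eval_dvd (x := t₀) (RatFunc.denom_inv_dvd hf0)
    rw [h, zero_dvd_iff] at this
    exact hnum this
  refine ⟨hreg, ?_⟩
  have h1 := (hf.mul (of_regularAt hreg)).unique ((mul_inv_cancel₀ hf0).symm ▸ one t₀)
  exact eq_inv_of_mul_eq_one_right h1

lemma div (hf : HasValueAt t₀ f a) (hg : HasValueAt t₀ g b) (hb : b ≠ 0) :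
    HasValueAt t₀ (f / g) (a / b) := by
  simpa [div_eq_mul_inv] using hf.mul (hg.inv hb)

end HasValueAt

lemma not_regularAt_iff {t₀ : ℚ} {f : RatFunc ℚ} :
    ¬ RegularAt t₀ f ↔ f ≠ 0 ∧ HasValueAt t₀ f⁻¹ 0 := by
  constructor
  · intro h
    have hd : f.denom.eval t₀ = 0 := by simpa [RegularAt] using h
    have hn : f.num.eval t₀ ≠ 0 := by
      intro hn
      obtain ⟨u, v, huv⟩ := f.isCoprime_num_denom
      simpa [hn, hd] using congrArg (eval t₀) huv
    have hf0 : f ≠ 0 := by rintro rfl; simp at hn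
    refine ⟨hf0, ?_⟩
    have := (HasValueAt.polynomial t₀ f.denom).div (HasValueAt.polynomial t₀ f.num) hn
    rwa [hd, zero_div, ← inv_div, RatFunc.num_div_denom] at this
  · rintro ⟨h0, h⟩ hf
    have := ((HasValueAt.of_regularAt hf).mul h).unique
      ((mul_inv_cancel₀ h0).symm ▸ HasValueAt.one t₀)
    simp at this

lemma regularAt_of_sq {t₀ : ℚ} {f : RatFunc ℚ} (h : RegularAt t₀ (f ^ 2)) : RegularAt t₀ f := by
  by_contra hf
  obtain ⟨h0, hi⟩ := not_regularAt_iff.mp hf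
  have := ((HasValueAt.of_regularAt h).mul (hi.pow 2)).unique
    (b := 1) (by rw [← mul_pow, mul_inv_cancel₀ h0, one_pow]; exact HasValueAt.one t₀)
  simp at this

/-- The functions regular at `t₀`. -/
def regularRing (t₀ : ℚ) : Subring (RatFunc ℚ) where
  carrier := {f | RegularAt t₀ f}
  mul_mem' := RegularAt.mul
  one_mem' := (HasValueAt.one t₀).1
  add_mem' := RegularAt.add
  zero_mem' := (HasValueAt.zero t₀).1
  neg_mem' h := (HasValueAt.of_regularAt h).neg.1

/-- Evaluation at `t₀` of the functions regular at `t₀`. -/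
def regularEval (t₀ : ℚ) : regularRing t₀ →+* ℚ where
  toFun f := valueAt t₀ f
  map_one' := (HasValueAt.one t₀).2
  map_mul' f g := valueAt_mul f.2 g.2
  map_zero' := (HasValueAt.zero t₀).2
  map_add' f g := valueAt_add f.2 g.2

/-! ### The chord-tangent law on y² = x³ + Ax + B. -/

section Chord

variable {K : Type*} [Field K] {A B x₁ y₁ x₂ y₂ : K}

lemma shortCurve_negY (A B x y : K) : (shortCurve A B).negY x y = -y := by
  simp [WeierstrassCurve.Affine.negY, shortCurve]

lemma shortCurve_addX (A B x₁ x₂ ℓ : K) :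
    (shortCurve A B).addX x₁ x₂ ℓ = ℓ ^ 2 - x₁ - x₂ := by
  simp [WeierstrassCurve.Affine.addX, shortCurve]

lemma shortCurve_addY (A B x₁ x₂ y₁ ℓ : K) :
    (shortCurve A B).addY x₁ x₂ y₁ ℓ = -(ℓ * (ℓ ^ 2 - x₁ - x₂ - x₁) + y₁) := by
  rw [WeierstrassCurve.Affine.addY, shortCurve_negY, WeierstrassCurve.Affine.negAddY,
    shortCurve_addX]

variable [DecidableEq K]

/-- Subtracting the curve equations and factoring both sides gives two division-free equations that
treat chords and tangents alike. Being polynomial identities, they can be evaluated at t₀ even when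
a chord degenerates to a tangent. -/
lemma shortCurve_slope (h₁ : (shortCurve A B).Equation x₁ y₁)
    (h₂ : (shortCurve A B).Equation x₂ y₂) (h : ¬(x₁ = x₂ ∧ y₁ = -y₂)) :
    (shortCurve A B).slope x₁ x₂ y₁ y₂ * (x₁ - x₂) = y₁ - y₂ ∧
    (shortCurve A B).slope x₁ x₂ y₁ y₂ * (y₁ + y₂) = x₁ ^ 2 + x₁ * x₂ + x₂ ^ 2 + A := by
  rw [shortCurve_equation_iff] at h₁ h₂
  by_cases hx : x₁ = x₂
  · subst hx
    have hy : y₁ + y₂ ≠ 0 := fun h' => h ⟨rfl, eq_neg_of_add_eq_zero_left h'⟩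
    have hyy : y₁ = y₂ := by
      have : (y₁ - y₂) * (y₁ + y₂) = 0 := by linear_combination h₁ - h₂
      exact sub_eq_zero.mp ((mul_eq_zero.mp this).resolve_right hy)
    subst hyy
    rw [WeierstrassCurve.Affine.slope_of_Y_ne rfl
      (by rw [shortCurve_negY]; exact fun h' => h ⟨rfl, h'⟩), shortCurve_negY]
    refine ⟨by ring, ?_⟩
    rw [sub_neg_eq_add, div_mul_cancel₀ _ hy]
    simp only [shortCurve]
    ring
  · have hx' : x₁ - x₂ ≠ 0 := sub_ne_zero.mpr hx
    rw [WeierstrassCurve.Affine.slope_of_X_ne hx]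
    refine ⟨div_mul_cancel₀ _ hx', ?_⟩
    field_simp
    linear_combination h₁ - h₂

/-- The `x`-coordinate of a sum is a root of the quadratic polynomial whose roots are the
`x`-coordinates of the sum and of the difference. -/
lemma shortCurve_sum_quadratic (h₁ : (shortCurve A B).Equation x₁ y₁)
    (h₂ : (shortCurve A B).Equation x₂ y₂) (h : ¬(x₁ = x₂ ∧ y₁ = -y₂)) {x₃ : K}
    (hx₃ : x₃ = (shortCurve A B).slope x₁ x₂ y₁ y₂ ^ 2 - x₁ - x₂) :
    (x₁ - x₂) ^ 2 * x₃ ^ 2 - 2 * ((x₁ * x₂ + A) * (x₁ + x₂) + 2 * B) * x₃ +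
      ((x₁ * x₂ - A) ^ 2 - 4 * B * (x₁ + x₂)) = 0 := by
  obtain ⟨hl₁, hl₂⟩ := shortCurve_slope h₁ h₂ h
  generalize (shortCurve A B).slope x₁ x₂ y₁ y₂ = ℓ at *
  rw [shortCurve_equation_iff] at h₁ h₂
  by_cases hx : x₁ = x₂
  · subst hx
    have hyy : y₁ = y₂ := by linear_combination -hl₁
    subst hyy
    rw [hx₃]
    linear_combination (-(ℓ * (y₁ + y₁)) - (x₁ ^ 2 + x₁ * x₁ + x₁ ^ 2 + A)) * hl₂ +
      4 * ℓ ^ 2 * h₁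
  · have hx' : (x₁ - x₂) ^ 2 ≠ 0 := pow_ne_zero _ (sub_ne_zero.mpr hx)
    -- The difference of the points has +2y₁y₂ here instead; multiplying by this conjugate leaves
    -- only y₁²y₂², which the curve equations eliminate.
    have hN : (x₁ - x₂) ^ 2 * x₃ = (x₁ * x₂ + A) * (x₁ + x₂) + 2 * B - 2 * y₁ * y₂ := by
      rw [hx₃]
      linear_combination (ℓ * (x₁ - x₂) + (y₁ - y₂)) * hl₁ + h₁ + h₂
    apply (mul_eq_zero.mp (?_ : (x₁ - x₂) ^ 2 * _ = 0)).resolve_left hx'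
    linear_combination ((x₁ - x₂) ^ 2 * x₃ - ((x₁ * x₂ + A) * (x₁ + x₂) + 2 * B) - 2 * y₁ * y₂) * hN
      + 4 * y₂ * y₂ * h₁ + 4 * (x₁ * x₁ * x₁ + A * x₁ + B) * h₂

lemma shortCurve_add_some (h₁ : (shortCurve A B).Nonsingular x₁ y₁)
    (h₂ : (shortCurve A B).Nonsingular x₂ y₂) (h : ¬(x₁ = x₂ ∧ y₁ = -y₂)) :
    ∃ h₃, WeierstrassCurve.Affine.Point.some x₁ y₁ h₁ + .some x₂ y₂ h₂ =
      .some ((shortCurve A B).slope x₁ x₂ y₁ y₂ ^ 2 - x₁ - x₂)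
        (-((shortCurve A B).slope x₁ x₂ y₁ y₂ *
          ((shortCurve A B).slope x₁ x₂ y₁ y₂ ^ 2 - x₁ - x₂ - x₁) + y₁)) h₃ := by
  have h' : ¬(x₁ = x₂ ∧ y₁ = (shortCurve A B).negY x₂ y₂) := by rwa [shortCurve_negY]
  have := WeierstrassCurve.Affine.nonsingular_add h₁ h₂ h'
  rw [shortCurve_addX, shortCurve_addY] at this
  refine ⟨this, ?_⟩
  rw [WeierstrassCurve.Affine.Point.add_some h']
  simp only [shortCurve_addX, shortCurve_addY]

lemma shortCurve_add_eq_zero (h₁ : (shortCurve A B).Nonsingular x₁ y₁)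
    (h₂ : (shortCurve A B).Nonsingular x₂ y₂) (h : x₁ = x₂ ∧ y₁ = -y₂) :
    WeierstrassCurve.Affine.Point.some x₁ y₁ h₁ + .some x₂ y₂ h₂ = 0 :=
  WeierstrassCurve.Affine.Point.add_of_Y_eq h.1 (by rw [shortCurve_negY, h.2])

end Chord

/-! ### Specialization at a place of good reduction is a homomorphism. -/

open WeierstrassCurve.Affine (Point)

namespace GoodAt

variable {A B : RatFunc ℚ} {t₀ : ℚ} {x y : RatFunc ℚ}

lemma hasValueAt_A (h : GoodAt A B t₀) : HasValueAt t₀ A (valueAt t₀ A) := .of_regularAt h.1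

lemma hasValueAt_B (h : GoodAt A B t₀) : HasValueAt t₀ B (valueAt t₀ B) := .of_regularAt h.2

lemma regularAt_iff (h : GoodAt A B t₀) (hxy : (shortCurve A B).Equation x y) :
    RegularAt t₀ x ↔ RegularAt t₀ y := by
  rw [shortCurve_equation_iff] at hxy
  have hA := h.hasValueAt_A
  have hB := h.hasValueAt_B
  constructor
  · intro hx
    have hx := HasValueAt.of_regularAt hx
    apply regularAt_of_sq
    rw [pow_two, hxy]
    exact (((hx.mul hx).mul hx).add (hA.mul hx)).add hB |>.1
  · intro hy
    by_contra hx
    have hy := HasValueAt.of_regularAt hy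
    obtain ⟨h0, hu⟩ := not_regularAt_iff.mp hx
    -- At a pole of x with y regular, the left side has value 0 and the right side 1.
    have e : y * y * x⁻¹ ^ 3 = 1 + A * x⁻¹ ^ 2 + B * x⁻¹ ^ 3 := by
      field_simp
      linear_combination hxy
    have h1 := (hy.mul hy).mul (hu.pow 3)
    rw [e] at h1
    have := h1.unique (((HasValueAt.one t₀).add (hA.mul (hu.pow 2))).add (hB.mul (hu.pow 3)))
    norm_num at this

lemma specialize_some (h : GoodAt A B t₀) (hxy : (shortCurve A B).Nonsingular x y) {a b : ℚ}
    (hx : HasValueAt t₀ x a) (hy : HasValueAt t₀ y b) :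
    ∃ hab, specialize h (.some x y hxy) = .some a b hab := by
  obtain ⟨hx, rfl⟩ := hx
  obtain ⟨hy, rfl⟩ := hy
  exact ⟨h.nonsingular hxy hx hy, dif_pos ⟨hx, hy⟩⟩

lemma specialize_zero (h : GoodAt A B t₀) : specialize h 0 = 0 := rfl

lemma specialize_some_eq_zero_iff (h : GoodAt A B t₀) (hxy : (shortCurve A B).Nonsingular x y) :
    specialize h (.some x y hxy) = 0 ↔ ¬ RegularAt t₀ x := by
  constructor
  · intro h0 hx
    obtain ⟨_, e⟩ := h.specialize_some hxy (.of_regularAt hx)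
      (.of_regularAt ((h.regularAt_iff hxy.1).mp hx))
    rw [e] at h0
    exact Point.some_ne_zero _ h0
  · intro hx
    exact dif_neg fun h' => hx h'.1

/-- A singular point of the reduction would be a double root of the cubic. -/
lemma not_singular (h : GoodAt A B t₀) {a : ℚ}
    (h₁ : (shortCurve (valueAt t₀ A) (valueAt t₀ B)).Equation a 0) :
    3 * a ^ 2 + valueAt t₀ A ≠ 0 := by
  intro h₂
  rw [shortCurve_equation_iff] at h₁
  apply h.disc_ne_zero
  have hA : valueAt t₀ A = -3 * a ^ 2 := by linear_combination h₂
  have hB : valueAt t₀ B = 2 * a ^ 3 := by rw [hA] at h₁; linear_combination -h₁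
  rw [hA, hB]
  ring

lemma specialize_neg (h : GoodAt A B t₀) (P : (shortCurve A B).Point) :
    specialize h (-P) = -specialize h P := by
  match P with
  | .zero => rfl
  | .some x y hxy =>
    rw [Point.neg_some]
    by_cases hx : RegularAt t₀ x
    · have hy := HasValueAt.of_regularAt ((h.regularAt_iff hxy.1).mp hx)
      have hx := HasValueAt.of_regularAt hx
      obtain ⟨_, e⟩ := h.specialize_some hxy hx hy
      obtain ⟨_, e'⟩ := h.specialize_some ((WeierstrassCurve.Affine.nonsingular_neg x y).mpr hxy)
        hx (by rw [shortCurve_negY]; exact hy.neg)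
      rw [e, e', Point.neg_some]
      simp only [shortCurve_negY]
    · rw [(h.specialize_some_eq_zero_iff _).mpr hx, (h.specialize_some_eq_zero_iff _).mpr hx,
        neg_zero]

lemma specialize_add_of_ne_zero (h : GoodAt A B t₀) {P Q : (shortCurve A B).Point}
    (hP : specialize h P ≠ 0) (hQ : specialize h Q ≠ 0) :
    specialize h (P + Q) = specialize h P + specialize h Q := by
  match P, Q with
  | .zero, _ => exact absurd rfl hP
  | _, .zero => exact absurd rfl hQ
  | .some x₁ y₁ h₁, .some x₂ y₂ h₂ =>
    rw [Ne, h.specialize_some_eq_zero_iff, not_not] at hP hQ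
    have hy₁ := HasValueAt.of_regularAt ((h.regularAt_iff h₁.1).mp hP)
    have hy₂ := HasValueAt.of_regularAt ((h.regularAt_iff h₂.1).mp hQ)
    have hx₁ := HasValueAt.of_regularAt hP
    have hx₂ := HasValueAt.of_regularAt hQ
    have hA := h.hasValueAt_A
    obtain ⟨g₁, e₁⟩ := h.specialize_some h₁ hx₁ hy₁
    obtain ⟨g₂, e₂⟩ := h.specialize_some h₂ hx₂ hy₂
    rw [e₁, e₂]
    generalize valueAt t₀ x₁ = a₁, valueAt t₀ x₂ = a₂, valueAt t₀ y₁ = b₁, valueAt t₀ y₂ = b₂ at *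
    by_cases hadd : x₁ = x₂ ∧ y₁ = -y₂
    · rw [shortCurve_add_eq_zero h₁ h₂ hadd, h.specialize_zero, shortCurve_add_eq_zero]
      obtain ⟨rfl, rfl⟩ := hadd
      exact ⟨hx₁.unique hx₂, hy₁.unique hy₂.neg⟩
    obtain ⟨h₃, e₃⟩ := shortCurve_add_some h₁ h₂ hadd
    obtain ⟨l₁, l₂⟩ := shortCurve_slope h₁.1 h₂.1 hadd
    rw [e₃]
    generalize (shortCurve A B).slope x₁ x₂ y₁ y₂ = ℓ at *
    have hS := (((hx₁.pow 2).add (hx₁.mul hx₂)).add (hx₂.pow 2)).add hA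
    by_cases hval : a₁ = a₂ ∧ b₁ = -b₂
    · rw [shortCurve_add_eq_zero g₁ g₂ hval, h.specialize_some_eq_zero_iff]
      -- If x₃ were regular, so would be ℓ² = x₃ + x₁ + x₂ and hence ℓ. Evaluating both slope
      -- equations at opposite points then gives b₂ = 0 and 3a² + A(t₀) = 0, a singular point.
      intro hx₃
      have hℓ : RegularAt t₀ ℓ := by
        apply regularAt_of_sq
        have := ((HasValueAt.of_regularAt hx₃).add hx₁).add hx₂
        convert this.1 using 1
        ring
      have hℓ := HasValueAt.of_regularAt hℓ
      have m₁ := (l₁ ▸ hℓ.mul (hx₁.sub hx₂)).unique (hy₁.sub hy₂)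
      have m₂ := (l₂ ▸ hℓ.mul (hy₁.add hy₂)).unique hS
      obtain ⟨rfl, rfl⟩ := hval
      have hb : b₂ = 0 := by linear_combination m₁ / 2
      subst hb
      exact h.not_singular g₂.1 (by linear_combination -m₂)
    -- Since the reduced points are not opposite, a₁ - a₂ or b₁ + b₂ is nonzero, and the
    -- corresponding slope equation determines the value of ℓ.
    · have key : ∃ c, HasValueAt t₀ ℓ c ∧
          (shortCurve (valueAt t₀ A) (valueAt t₀ B)).slope a₁ a₂ b₁ b₂ = c := by
        obtain ⟨m₁, m₂⟩ := shortCurve_slope g₁.1 g₂.1 hval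
        by_cases ha : a₁ = a₂
        · have hb : b₁ + b₂ ≠ 0 := fun h' => hval ⟨ha, eq_neg_of_add_eq_zero_left h'⟩
          have hy : y₁ + y₂ ≠ 0 := fun h' => hb ((hy₁.add hy₂).unique (h' ▸ HasValueAt.zero t₀))
          refine ⟨_, ?_, eq_div_of_mul_eq hb m₂⟩
          rw [eq_div_of_mul_eq hy l₂]
          exact hS.div (hy₁.add hy₂) hb
        · have hb : a₁ - a₂ ≠ 0 := sub_ne_zero.mpr ha
          have hy : x₁ - x₂ ≠ 0 := fun h' => hb ((hx₁.sub hx₂).unique (h' ▸ HasValueAt.zero t₀))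
          refine ⟨_, ?_, eq_div_of_mul_eq hb m₁⟩
          rw [eq_div_of_mul_eq hy l₁]
          exact (hy₁.sub hy₂).div (hx₁.sub hx₂) hb
      obtain ⟨c, hc, hc'⟩ := key
      obtain ⟨g₃, f₃⟩ := shortCurve_add_some g₁ g₂ hval
      rw [f₃]
      simp only [hc']
      have hx₃ := ((hc.pow 2).sub hx₁).sub hx₂
      exact (h.specialize_some h₃ hx₃ ((hc.mul (hx₃.sub hx₁)).add hy₁).neg).2

/-- Divide the quadratic equation for x₃ by (x₁x₂)². Its coefficients become polynomials in A, B and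
1/x₁, 1/x₂, which vanish at t₀; if x₃ were regular, evaluation would give 1 = 0. -/
lemma specialize_add_of_eq_zero (h : GoodAt A B t₀) {P Q : (shortCurve A B).Point}
    (hP : specialize h P = 0) (hQ : specialize h Q = 0) : specialize h (P + Q) = 0 := by
  match P, Q with
  | .zero, _ => simpa [← Point.zero_def] using hQ
  | _, .zero => simpa [← Point.zero_def] using hP
  | .some x₁ y₁ h₁, .some x₂ y₂ h₂ =>
    rw [h.specialize_some_eq_zero_iff, not_regularAt_iff] at hP hQ
    obtain ⟨hx₁, hu₁⟩ := hP
    obtain ⟨hx₂, hu₂⟩ := hQ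
    by_cases hadd : x₁ = x₂ ∧ y₁ = -y₂
    · rw [shortCurve_add_eq_zero h₁ h₂ hadd, h.specialize_zero]
    obtain ⟨h₃, e₃⟩ := shortCurve_add_some h₁ h₂ hadd
    rw [e₃, h.specialize_some_eq_zero_iff]
    have hq := shortCurve_sum_quadratic h₁.1 h₂.1 hadd rfl
    generalize (shortCurve A B).slope x₁ x₂ y₁ y₂ ^ 2 - x₁ - x₂ = x₃ at *
    intro hx₃
    have hx₃ := HasValueAt.of_regularAt hx₃
    have hA := h.hasValueAt_A
    have hB := h.hasValueAt_B
    have two := HasValueAt.ofNat t₀ 2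
    have four := HasValueAt.ofNat t₀ 4
    have huu := hu₁.mul hu₂
    have key := ((((hu₂.sub hu₁).pow 2).mul (hx₃.pow 2)).sub
      ((two.mul ((((HasValueAt.one t₀).add (hA.mul huu)).mul (hu₁.add hu₂)).add
        (two.mul (hB.mul (huu.pow 2))))).mul hx₃)).add
      ((((HasValueAt.one t₀).sub (hA.mul huu)).pow 2).sub
        (four.mul (hB.mul (huu.mul (hu₁.add hu₂)))))
    have e := key.unique (b := 0) (by
      convert HasValueAt.zero t₀ using 1
      field_simp
      linear_combination hq)
    norm_num at e

/-- At a place of good reduction, specialization is a homomorphism. -/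
def specializeHom (h : GoodAt A B t₀) :
    (shortCurve A B).Point →+ (shortCurve (valueAt t₀ A) (valueAt t₀ B)).Point where
  toFun := specialize h
  map_zero' := rfl
  map_add' := by
    -- The mixed case is formal: P = (P + Q) - Q shows that P + Q does not reduce to O, and then Q =
    -- (P + Q) - P is a sum of two points not reducing to O.
    have mixed : ∀ P Q : (shortCurve A B).Point, specialize h P ≠ 0 → specialize h Q = 0 →
        specialize h (P + Q) = specialize h P := by
      intro P Q hP hQ
      have hPQ : specialize h (P + Q) ≠ 0 := by
        intro h0
        apply hP
        have := h.specialize_add_of_eq_zero h0 (Q := -Q) (by rw [specialize_neg, hQ, neg_zero])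
        rwa [add_neg_cancel_right] at this
      have := h.specialize_add_of_ne_zero hPQ (Q := -P) (by rwa [specialize_neg, neg_ne_zero])
      rw [add_neg_cancel_comm, specialize_neg, hQ] at this
      exact (add_neg_eq_zero.mp this.symm)
    intro P Q
    by_cases hP : specialize h P = 0 <;> by_cases hQ : specialize h Q = 0
    · rw [h.specialize_add_of_eq_zero hP hQ, hP, hQ, add_zero]
    · rw [add_comm, mixed Q P hQ hP, hP, zero_add]
    · rw [mixed P Q hP hQ, hQ, add_zero]
    · exact h.specialize_add_of_ne_zero hP hQ

end GoodAt

/-! ### The x-coordinate of a multiple as a rational function. -/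

section MultiplicationPolynomials

variable {R : Type*} [CommRing R]

/-- Numerator and denominator, not in lowest terms, of the `x`-coordinate of `(n + 1)Q` as a
rational function of the `x`-coordinate of `Q`. Each denominator is divisible by all the previous ones. -/
def mulX (A B : R) : ℕ → R[X] × R[X]
  | 0 => (X, 1)
  | 1 => ((X ^ 2 - C A) ^ 2 - C (8 * B) * X, C 4 * (X ^ 3 + C A * X + C B))
  | n + 2 =>
    -- With R = (n + 2)Q, the sum x(R + Q) + x(R - Q) is rational in x(R) and x(Q), and R - Q = (n +
    -- 1)Q has x-coordinate p'/q'. The superfluous factor q makes all earlier denominators divide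
    -- this one.
    let (p', q') := mulX A B n
    let (p, q) := mulX A B (n + 1)
    ((C 2 * ((X * p + C A * q) * (X * q + p) + C (2 * B) * q ^ 2) * q' -
        (p - X * q) ^ 2 * p') * q,
      (p - X * q) ^ 2 * q' * q)

lemma mulX_add_two (A B : R) (n : ℕ) :
    mulX A B (n + 2) =
    ((C 2 * ((X * (mulX A B (n + 1)).1 + C A * (mulX A B (n + 1)).2) *
          (X * (mulX A B (n + 1)).2 + (mulX A B (n + 1)).1) +
          C (2 * B) * (mulX A B (n + 1)).2 ^ 2) * (mulX A B n).2 -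
        ((mulX A B (n + 1)).1 - X * (mulX A B (n + 1)).2) ^ 2 * (mulX A B n).1) *
          (mulX A B (n + 1)).2,
      ((mulX A B (n + 1)).1 - X * (mulX A B (n + 1)).2) ^ 2 * (mulX A B n).2 *
        (mulX A B (n + 1)).2) := by
  rw [mulX]

/-- Used for the inclusion into ℚ(t) and the evaluation at t of the ring of functions regular at t,
so that one polynomial serves both curves. -/
lemma map_mulX {S : Type*} [CommRing S] (f : R →+* S) (A B : R) (n : ℕ) :
    (mulX (f A) (f B) n).1 = (mulX A B n).1.map f ∧
      (mulX (f A) (f B) n).2 = (mulX A B n).2.map f := by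
  induction n using Nat.twoStepInduction with
  | zero => simp [mulX]
  | one => simp [mulX, _root_.map_ofNat f]
  | more n ih ih' =>
    simp only [mulX_add_two, ih.1, ih.2, ih'.1, ih'.2, Polynomial.map_mul, Polynomial.map_sub,
      Polynomial.map_add, Polynomial.map_pow, map_X, map_C, map_mul, _root_.map_ofNat,
      Polynomial.map_ofNat, and_self]

/-- `p` has degree at most `d`, with coefficient `a` in degree `d`. -/
def HasTopCoeff (p : R[X]) (d : ℕ) (a : R) : Prop := p.natDegree ≤ d ∧ p.coeff d = a

namespace HasTopCoeff

variable {p q : R[X]} {d e : ℕ} {a b : R}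

lemma mul (hp : HasTopCoeff p d a) (hq : HasTopCoeff q e b) :
    HasTopCoeff (p * q) (d + e) (a * b) :=
  ⟨natDegree_mul_le_of_le hp.1 hq.1, by rw [coeff_mul_add_eq_of_natDegree_le hp.1 hq.1, hp.2, hq.2]⟩

lemma add (hp : HasTopCoeff p d a) (hq : HasTopCoeff q d b) : HasTopCoeff (p + q) d (a + b) :=
  ⟨natDegree_add_le_of_degree_le hp.1 hq.1, by rw [coeff_add, hp.2, hq.2]⟩

lemma sub (hp : HasTopCoeff p d a) (hq : HasTopCoeff q d b) : HasTopCoeff (p - q) d (a - b) :=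
  ⟨natDegree_sub_le_of_le hp.1 hq.1 |>.trans (max_self d).le, by rw [coeff_sub, hp.2, hq.2]⟩

lemma X : HasTopCoeff (X : R[X]) 1 1 := ⟨natDegree_X_le, coeff_X_one⟩

lemma const (c : R) : HasTopCoeff (C c) 0 c := ⟨(natDegree_C c).le, coeff_C_zero⟩

lemma lift (hp : HasTopCoeff p d a) (h : d < e) : HasTopCoeff p e 0 :=
  ⟨hp.1.trans h.le, coeff_eq_zero_of_natDegree_lt (hp.1.trans_lt h)⟩

lemma congr (hp : HasTopCoeff p d a) (hd : d = e) (ha : a = b) : HasTopCoeff p e b := by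
  rwa [← hd, ← ha]

lemma ne_zero (hp : HasTopCoeff p d a) (ha : a ≠ 0) : p ≠ 0 := by
  rintro rfl
  exact ha (by simpa using hp.2.symm)

lemma pow_two (hp : HasTopCoeff p d a) : HasTopCoeff (p ^ 2) (d + d) (a ^ 2) := by
  rw [_root_.pow_two, _root_.pow_two]
  exact hp.mul hp

end HasTopCoeff

variable {K : Type*} [Field K]

/-- The `x`-coordinate of `(n + 1)Q` has a simple pole at infinity, with leading
coefficient `1 / (n + 1)²`. -/
lemma hasTopCoeff_mulX [CharZero K] (A B : K) (n : ℕ) :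
    ∃ d a, a ≠ 0 ∧ HasTopCoeff (mulX A B n).1 (d + 1) a ∧
      HasTopCoeff (mulX A B n).2 d ((n + 1) ^ 2 * a) := by
  induction n using Nat.twoStepInduction with
  | zero => exact ⟨0, 1, one_ne_zero, .X, by simpa [mulX] using HasTopCoeff.const (1 : K)⟩
  | one =>
    refine ⟨3, 1, one_ne_zero, ?_, ?_⟩
    · have h := (((HasTopCoeff.X.pow_two).sub ((HasTopCoeff.const A).lift two_pos)).pow_two).sub
        (((HasTopCoeff.const (8 * B)).mul .X).lift (e := 4) (by norm_num))
      exact h.congr rfl (by simp)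
    · have h3 : HasTopCoeff (X ^ 3 : K[X]) 3 1 := by
        rw [pow_succ]
        exact (HasTopCoeff.X.pow_two.mul .X).congr rfl (by simp)
      have h := (HasTopCoeff.const (4 : K)).mul ((h3.add
        (((HasTopCoeff.const A).mul .X).lift (by norm_num))).add
          ((HasTopCoeff.const B).lift (by norm_num)))
      exact h.congr rfl (by norm_num)
  | more n ih ih' =>
    obtain ⟨e, b, hb, hp', hq'⟩ := ih
    obtain ⟨d, a, ha, hp, hq⟩ := ih'
    rw [mulX_add_two]
    generalize (mulX A B n).1 = p', (mulX A B n).2 = q', (mulX A B (n + 1)).1 = p,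
      (mulX A B (n + 1)).2 = q at *
    have hD := (hp.sub ((HasTopCoeff.X.mul hq).congr (add_comm _ _) rfl)).pow_two
    have hN₁ := (HasTopCoeff.X.mul hp).add
      (((HasTopCoeff.const A).mul hq).lift (e := 1 + (d + 1)) (by omega))
    have hN₂ := ((HasTopCoeff.X.mul hq).congr (add_comm _ _) rfl).add hp
    have hN := (HasTopCoeff.const (2 : K)).mul ((hN₁.mul hN₂).add
      (((HasTopCoeff.const (2 * B)).mul hq.pow_two).lift (by omega)))
    have hnum := ((hN.mul hq').sub ((hD.mul hp').congr (by omega) rfl)).mul hq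
    have hden := (hD.mul hq').mul hq
    have h1 : ((n : K) + 1) ≠ 0 := by exact_mod_cast n.succ_ne_zero
    have h2 : ((n : K) + 2) ≠ 0 := by exact_mod_cast (n + 1).succ_ne_zero
    -- The top coefficient of p - Xq is a(1 - (n + 2)²) = -a(n + 1)(n + 3); its square supplies the
    -- required factor (n + 3)².
    refine ⟨d + 1 + (d + 1) + e + d, a ^ 3 * b * (n + 1) ^ 4 * (n + 2) ^ 2, ?_,
      hnum.congr (by omega) ?_, hden.congr rfl ?_⟩
    · positivity
    · push_cast
      ring
    · push_cast
      ring

variable [DecidableEq K] {A B : K}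

/-- The two slopes are (y₁ ∓ y)/(x₁ - x); adding their squares cancels the cross terms y₁y. -/
lemma sum_add_difference_x {x y x₁ y₁ x₂ y₂ x₃ y₃ : K} {h : (shortCurve A B).Nonsingular x y}
    {h₁ : (shortCurve A B).Nonsingular x₁ y₁} {h₂ : (shortCurve A B).Nonsingular x₂ y₂}
    {h₃ : (shortCurve A B).Nonsingular x₃ y₃} (hx : x₁ ≠ x)
    (hs : Point.some x₁ y₁ h₁ + .some x y h = .some x₂ y₂ h₂)
    (hd : Point.some x₁ y₁ h₁ - .some x y h = .some x₃ y₃ h₃) :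
    (x₁ - x) ^ 2 * (x₂ + x₃) = 2 * ((x * x₁ + A) * (x + x₁) + 2 * B) := by
  rw [sub_eq_add_neg, Point.neg_some] at hd
  obtain ⟨_, e₂⟩ := shortCurve_add_some h₁ h (fun h' => hx h'.1)
  obtain ⟨_, e₃⟩ := shortCurve_add_some h₁ ((WeierstrassCurve.Affine.nonsingular_neg x y).mpr h)
    (fun h' => hx h'.1)
  rw [e₂] at hs
  rw [e₃] at hd
  injection hs with hs _
  injection hd with hd _
  have hx' := sub_ne_zero.mpr hx
  rw [WeierstrassCurve.Affine.slope_of_X_ne hx] at hs hd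
  rw [shortCurve_negY] at hd
  have c₁ := (shortCurve_equation_iff ..).mp h₁.1
  have c := (shortCurve_equation_iff ..).mp h.1
  rw [← hs, ← hd]
  field_simp
  linear_combination 2 * c₁ + 2 * c

/-- Away from the zeros of the denominator, `mulX` computes the `x`-coordinate of a multiple. -/
lemma nsmul_eq_some {x y : K} (h : (shortCurve A B).Nonsingular x y) (n : ℕ)
    (hn : (mulX A B n).2.eval x ≠ 0) :
    ∃ y' h', (n + 1) • Point.some x y h =
      .some ((mulX A B n).1.eval x / (mulX A B n).2.eval x) y' h' := by
  induction n using Nat.twoStepInduction with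
  | zero =>
    have e : (mulX A B 0).1.eval x / (mulX A B 0).2.eval x = x := by simp [mulX]
    rw [e]
    exact ⟨y, h, by simp⟩
  | one =>
    have c := (shortCurve_equation_iff ..).mp h.1
    have hy : 2 * y ≠ 0 := by
      rintro hy
      apply hn
      simp only [mulX, eval_mul, eval_add, eval_C, eval_pow, eval_X]
      linear_combination -4 * c + 2 * y * hy
    have hadd : ¬(x = x ∧ y = -y) := fun h' => hy (by linear_combination h'.2)
    obtain ⟨h₃, e₃⟩ := shortCurve_add_some h h hadd
    obtain ⟨-, l⟩ := shortCurve_slope h.1 h.1 hadd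
    rw [one_add_one_eq_two, two_nsmul, e₃]
    generalize (shortCurve A B).slope x x y y = ℓ at *
    have e : ℓ ^ 2 - x - x = (mulX A B 1).1.eval x / (mulX A B 1).2.eval x := by
      rw [eq_div_iff hn]
      simp only [mulX, eval_mul, eval_add, eval_sub, eval_C, eval_pow, eval_X]
      linear_combination (ℓ * (y + y) + (3 * x ^ 2 + A)) * l - 4 * ℓ ^ 2 * c
    simp only [← e]
    exact ⟨_, h₃, rfl⟩
  | more n ih ih' =>
    have hn' := hn
    rw [mulX_add_two] at hn'
    simp only [eval_mul, eval_sub, eval_pow, eval_X, mul_ne_zero_iff,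
      pow_ne_zero_iff two_ne_zero] at hn'
    obtain ⟨⟨hD, hq'⟩, hq⟩ := hn'
    obtain ⟨y₃, h₃, e₃⟩ := ih hq'
    obtain ⟨y₁, h₁, e₁⟩ := ih' hq
    have hx : (mulX A B (n + 1)).1.eval x / (mulX A B (n + 1)).2.eval x ≠ x := by
      intro h'
      apply hD
      rw [div_eq_iff hq] at h'
      linear_combination h'
    obtain ⟨h₂, e₂⟩ := shortCurve_add_some h₁ h (fun h' => hx h'.1)
    have hdiff : Point.some _ y₁ h₁ - .some x y h = .some _ y₃ h₃ := by
      rw [← e₁, ← e₃, succ_nsmul _ (n + 1), add_sub_cancel_right]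
    have hsum := sum_add_difference_x hx e₂ hdiff
    rw [show n + 2 + 1 = (n + 1 + 1) + 1 from rfl, succ_nsmul, e₁, e₂]
    generalize (shortCurve A B).slope _ x y₁ y ^ 2 - _ - x = x₂ at *
    have e : x₂ = (mulX A B (n + 2)).1.eval x / (mulX A B (n + 2)).2.eval x := by
      rw [eq_div_iff hn, mulX_add_two]
      simp only [eval_mul, eval_add, eval_sub, eval_C, eval_pow, eval_X]
      clear ih ih' e₁ e₂ e₃ h₁ h₂ h₃ hdiff hn
      generalize (mulX A B n).1.eval x = p', (mulX A B n).2.eval x = q',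
        (mulX A B (n + 1)).1.eval x = p, (mulX A B (n + 1)).2.eval x = q at *
      field_simp at hsum
      linear_combination q * hsum
    simp only [← e]
    exact ⟨_, h₂, rfl⟩

end MultiplicationPolynomials

/-! ### Hilbert sets up to finite sets, and lifting of rational roots. -/

/-- The filter of sets containing all but finitely many elements of some Hilbert set. -/
def hilbertFilter : Filter ℚ where
  sets := {s | ∃ F : Finset ℚ[X][X], (∀ f ∈ F, Irreducible f ∧ 0 < f.natDegree) ∧
    ({t | ∀ f ∈ F, Irreducible (f.map (evalRingHom t))} \ s).Finite}
  univ_sets := ⟨∅, by simp, by simp⟩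
  sets_of_superset := by
    rintro s s' ⟨F, hF, hfin⟩ hs
    exact ⟨F, hF, hfin.subset (Set.sdiff_subset_sdiff_right hs)⟩
  inter_sets := by
    classical
    rintro s s' ⟨F, hF, hfin⟩ ⟨F', hF', hfin'⟩
    refine ⟨F ∪ F', fun f hf => (Finset.mem_union.mp hf).elim (hF f) (hF' f),
      (hfin.union hfin').subset ?_⟩
    rintro t ⟨ht, hts⟩
    by_cases h : t ∈ s
    · exact .inr ⟨fun f hf => ht f (Finset.mem_union_right _ hf), fun h' => hts ⟨h, h'⟩⟩
    · exact .inl ⟨fun f hf => ht f (Finset.mem_union_left _ hf), h⟩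

lemma exists_isHilbertSet_of_mem_hilbertFilter {s : Set ℚ} (hs : s ∈ hilbertFilter) :
    ∃ S H : Set ℚ, IsHilbertSet H ∧ (symmDiff S H).Finite ∧ S ⊆ s := by
  obtain ⟨F, hF, hfin⟩ := hs
  refine ⟨{t | ∀ f ∈ F, Irreducible (f.map (evalRingHom t))} ∩ s, _, ⟨F, hF, rfl⟩,
    hfin.subset ?_, Set.inter_subset_right⟩
  rintro t (⟨h, h'⟩ | ⟨h, h'⟩)
  · exact absurd h.1 h'
  · exact ⟨h, fun hs => h' ⟨h, hs⟩⟩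

lemma eventually_notMem_of_finite {T : Set ℚ} (hT : T.Finite) : ∀ᶠ t in hilbertFilter, t ∉ T :=
  ⟨∅, by simp, hT.subset fun t ht => by simpa using ht.2⟩

lemma eventually_eval_ne_zero {p : ℚ[X]} (hp : p ≠ 0) : ∀ᶠ t in hilbertFilter, p.eval t ≠ 0 := by
  filter_upwards [eventually_notMem_of_finite (p.rootSet_finite ℚ)] with t ht h
  exact ht ((mem_rootSet_of_ne hp).mpr (by simpa using h))

lemma eventually_irreducible {f : ℚ[X][X]} (hf : Irreducible f) (hd : 0 < f.natDegree) :
    ∀ᶠ t in hilbertFilter, Irreducible (f.map (evalRingHom t)) :=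
  ⟨{f}, by simp [hf, hd], by simp⟩

lemma eventually_regularAt (f : RatFunc ℚ) : ∀ᶠ t in hilbertFilter, RegularAt t f :=
  eventually_eval_ne_zero f.denom_ne_zero

/-- If `f ∈ ℚ[t, x]` is irreducible, then outside of an exceptional set the rational zeros of a
specialization of `f` come from zeros of `f` in `ℚ(t)`. -/
lemma eventually_exists_root_of_irreducible {f : ℚ[X][X]} (hf : Irreducible f) :
    ∀ᶠ t in hilbertFilter, ∀ x, (f.map (evalRingHom t)).eval x = 0 →
      ∃ a, HasValueAt t a x ∧ (f.map (algebraMap ℚ[X] (RatFunc ℚ))).eval a = 0 := by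
  have hlead : f.leadingCoeff ≠ 0 := leadingCoeff_ne_zero.mpr hf.ne_zero
  rcases Nat.eq_zero_or_pos f.natDegree with hd | hd
  · filter_upwards [eventually_eval_ne_zero hlead] with t ht x hx
    rw [eq_C_of_natDegree_eq_zero hd] at hx
    rw [leadingCoeff, hd] at ht
    simp [ht] at hx
  filter_upwards [eventually_eval_ne_zero hlead, eventually_irreducible hf hd] with t ht hirr x hx
  have hdeg : (f.map (evalRingHom t)).natDegree = f.natDegree :=
    natDegree_map_of_leadingCoeff_ne_zero _ ht
  -- An irreducible polynomial with a rational root is linear, so f = px + q and the root is the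
  -- value of -q/p.
  have h1 : f.natDegree = 1 := by
    rw [← hdeg]
    exact natDegree_eq_of_degree_eq_some (degree_eq_one_of_irreducible_of_root hirr hx)
  rw [leadingCoeff, h1] at ht
  obtain ⟨p, q, rfl⟩ : ∃ p q, f = C p * X + C q := ⟨_, _, eq_X_add_C_of_natDegree_le_one h1.le⟩
  simp only [coeff_add, coeff_C_mul, coeff_X_one, mul_one, coeff_C_succ, add_zero] at ht
  have hp : algebraMap ℚ[X] (RatFunc ℚ) p ≠ 0 := by
    apply RatFunc.algebraMap_ne_zero
    rintro rfl
    simp at ht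
  refine ⟨-algebraMap _ _ q / algebraMap _ _ p, ?_, ?_⟩
  · have := (HasValueAt.polynomial t q).neg.div (HasValueAt.polynomial t p) ht
    convert this using 1
    rw [eq_div_iff ht]
    simp only [Polynomial.map_add, Polynomial.map_mul, map_C, map_X, eval_add, eval_mul, eval_C,
      eval_X, coe_evalRingHom] at hx
    linear_combination hx
  · simp only [Polynomial.map_add, Polynomial.map_mul, map_C, map_X, eval_add, eval_mul, eval_C,
      eval_X]
    field_simp
    ring

/-- A root belongs to one of the irreducible factors in ℚ[t][x]; finitely many exceptional sets
combine into one. -/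
lemma eventually_exists_root_polynomial {f : ℚ[X][X]} (hf : f ≠ 0) :
    ∀ᶠ t in hilbertFilter, ∀ x, (f.map (evalRingHom t)).eval x = 0 →
      ∃ a, HasValueAt t a x ∧ (f.map (algebraMap ℚ[X] (RatFunc ℚ))).eval a = 0 := by
  induction f using WfDvdMonoid.induction_on_irreducible with
  | zero => exact absurd rfl hf
  | unit u hu =>
    refine Filter.Eventually.of_forall fun t x hx => ?_
    have := (hu.map (mapRingHom (evalRingHom t))).map (evalRingHom x)
    simp [hx] at this
  | mul f i hf0 hi ih =>
    filter_upwards [ih hf0, eventually_exists_root_of_irreducible hi] with t h₁ h₂ x hx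
    rw [Polynomial.map_mul, eval_mul, mul_eq_zero] at hx
    rcases hx with hx | hx
    · obtain ⟨a, ha, h⟩ := h₂ x hx
      exact ⟨a, ha, by simp [h]⟩
    · obtain ⟨a, ha, h⟩ := h₁ x hx
      exact ⟨a, ha, by simp [h]⟩

/-- Polynomials as functions regular at `t`. -/
def polynomialToRegular (t : ℚ) : ℚ[X] →+* regularRing t :=
  (algebraMap ℚ[X] (RatFunc ℚ)).codRestrict (regularRing t) fun p => (HasValueAt.polynomial t p).1

lemma regularEval_comp_polynomialToRegular (t : ℚ) :
    (regularEval t).comp (polynomialToRegular t) = evalRingHom t :=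
  RingHom.ext fun p => (HasValueAt.polynomial t p).2

/-- Outside of an exceptional set, the rational zeros of a specialization of `f ∈ ℚ(t)[x]` come from
zeros of `f` in `ℚ(t)`. -/
lemma eventually_exists_root {f : (RatFunc ℚ)[X]} (hf : f ≠ 0) :
    ∀ᶠ t in hilbertFilter, ∀ f₀ : (regularRing t)[X], f₀.map (regularRing t).subtype = f →
      ∀ x, (f₀.map (regularEval t)).eval x = 0 → ∃ a, HasValueAt t a x ∧ f.eval a = 0 := by
  obtain ⟨b, hb, hg⟩ := IsLocalization.integerNormalization_spec (nonZeroDivisors ℚ[X]) f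
  have hg0 : IsLocalization.integerNormalization (nonZeroDivisors ℚ[X]) f ≠ 0 := by
    rwa [Ne, IsFractionRing.integerNormalization_eq_zero_iff]
  generalize IsLocalization.integerNormalization (nonZeroDivisors ℚ[X]) f = g at hg hg0
  have hb0 : algebraMap ℚ[X] (RatFunc ℚ) b ≠ 0 :=
    RatFunc.algebraMap_ne_zero (nonZeroDivisors.ne_zero hb)
  have hg' : g.map (algebraMap ℚ[X] (RatFunc ℚ)) = C (algebraMap ℚ[X] (RatFunc ℚ) b) * f := by
    rw [hg, ← smul_eq_C_mul, algebraMap_smul]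
  filter_upwards [eventually_exists_root_polynomial hg0] with t ht f₀ hf₀ x hx
  -- The identity after clearing denominators already holds over the functions regular at t, so it
  -- can be evaluated there, whether or not b(t) = 0.
  have e : g.map (polynomialToRegular t) = C (polynomialToRegular t b) * f₀ := by
    apply map_injective (regularRing t).subtype Subtype.val_injective
    rw [Polynomial.map_mul, map_C, hf₀, Polynomial.map_map]
    exact hg'
  obtain ⟨a, ha, hga⟩ := ht x (by
    rw [← regularEval_comp_polynomialToRegular, ← Polynomial.map_map, e, Polynomial.map_mul,
      eval_mul, hx, mul_zero])
  refine ⟨a, ha, ?_⟩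
  rw [hg', eval_mul, eval_C] at hga
  exact (mul_eq_zero.mp hga).resolve_left hb0

/-! ### Lifting n-th parts of a specialized point. -/

section Lifting

variable {A B : RatFunc ℚ}

lemma eventually_goodAt (hE : 4 * A ^ 3 + 27 * B ^ 2 ≠ 0) :
    ∀ᶠ t in hilbertFilter, GoodAt A B t := by
  filter_upwards [eventually_regularAt A, eventually_regularAt B,
    eventually_regularAt (4 * A ^ 3 + 27 * B ^ 2)⁻¹] with t hA hB hD
  refine ⟨hA, hB, fun h0 => ?_⟩
  have h := ((HasValueAt.ofNat t 4).mul ((HasValueAt.of_regularAt hA).pow 3)).add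
    ((HasValueAt.ofNat t 27).mul ((HasValueAt.of_regularAt hB).pow 2))
  have := (h.mul (.of_regularAt hD)).unique ((mul_inv_cancel₀ hE).symm ▸ HasValueAt.one t)
  rw [h0, zero_mul] at this
  exact zero_ne_one this

/-- Only the finitely many poles of the x-coordinate have to be avoided. -/
lemma eventually_specialize_ne_zero {P : (shortCurve A B).Point} (hP : P ≠ 0) :
    ∀ᶠ t in hilbertFilter, ∀ h : GoodAt A B t, specialize h P ≠ 0 := by
  match P with
  | .zero => exact absurd rfl hP
  | .some x y hxy =>
    filter_upwards [eventually_regularAt x] with t hx h h0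
    exact (h.specialize_some_eq_zero_iff hxy).mp h0 hx

/-- The `x`-coordinates of the points `Q` with `(n + 1)Q = P` satisfy a polynomial equation,
compatibly with specialization. -/
lemma exists_division_polynomial (n : ℕ) (P : (shortCurve A B).Point) :
    ∃ f : (RatFunc ℚ)[X], f ≠ 0 ∧ ∀ᶠ t in hilbertFilter, ∀ h : GoodAt A B t,
      ∃ f₀ : (regularRing t)[X], f₀.map (regularRing t).subtype = f ∧
        ∀ x y hxy, (n + 1) • Point.some x y hxy = specialize h P →
          (f₀.map (regularEval t)).eval x = 0 := by
  obtain ⟨d, a, ha, hp, hq⟩ := hasTopCoeff_mulX A B n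
  have hq0 : (mulX A B n).2 ≠ 0 := hq.ne_zero
    (mul_ne_zero (pow_ne_zero _ (by exact_mod_cast n.succ_ne_zero)) ha)
  match P with
  | .zero =>
    refine ⟨(mulX A B n).2, hq0, .of_forall fun t h => ?_⟩
    let A' : regularRing t := ⟨A, h.1⟩
    let B' : regularRing t := ⟨B, h.2⟩
    refine ⟨(mulX A' B' n).2, (map_mulX (regularRing t).subtype A' B' n).2.symm, ?_⟩
    intro x y hxy hxP
    by_contra hx
    rw [← (map_mulX (regularEval t) A' B' n).2] at hx
    obtain ⟨_, h', e⟩ := nsmul_eq_some hxy n hx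
    rw [e] at hxP
    exact Point.some_ne_zero h' hxP
  | .some c b hcb =>
    -- The second factor says that (n + 1)Q has x-coordinate c; the first absorbs the points where
    -- the formula for the multiple breaks down. The simple pole at infinity makes the second factor
    -- nonzero.
    refine ⟨(mulX A B n).2 * ((mulX A B n).1 - C c * (mulX A B n).2), mul_ne_zero hq0 ?_, ?_⟩
    · exact (hp.sub (((HasTopCoeff.const c).mul hq).lift (by omega))).ne_zero (by simpa using ha)
    filter_upwards [eventually_regularAt c] with t hc h
    let A' : regularRing t := ⟨A, h.1⟩
    let B' : regularRing t := ⟨B, h.2⟩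
    let c' : regularRing t := ⟨c, hc⟩
    have hA := map_mulX (regularRing t).subtype A' B' n
    have hA' := map_mulX (regularEval t) A' B' n
    refine ⟨(mulX A' B' n).2 * ((mulX A' B' n).1 - C c' * (mulX A' B' n).2), ?_, ?_⟩
    · simp only [Polynomial.map_mul, Polynomial.map_sub, map_C, ← hA.1, ← hA.2]
      rfl
    intro x y hxy hxP
    simp only [Polynomial.map_mul, Polynomial.map_sub, map_C, ← hA'.1, ← hA'.2, eval_mul,
      eval_sub, eval_C, mul_eq_zero]
    by_contra! hx
    obtain ⟨_, h', e⟩ := nsmul_eq_some hxy n hx.1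
    obtain ⟨_, e'⟩ := h.specialize_some hcb (.of_regularAt hc)
      (.of_regularAt ((h.regularAt_iff hcb.1).mp hc))
    rw [e, e'] at hxP
    injection hxP with hxP _
    apply hx.2
    rw [sub_eq_zero]
    exact (div_eq_iff hx.1).mp hxP

lemma ratFunc_nonsingular (hE : 4 * A ^ 3 + 27 * B ^ 2 ≠ 0) {x y : RatFunc ℚ}
    (h : (shortCurve A B).Equation x y) : (shortCurve A B).Nonsingular x y := by
  refine (WeierstrassCurve.Affine.equation_iff_nonsingular_of_Δ_ne_zero ?_).mp h
  have : (shortCurve A B).Δ = -16 * (4 * A ^ 3 + 27 * B ^ 2) := by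
    simp only [WeierstrassCurve.Δ, WeierstrassCurve.b₂, WeierstrassCurve.b₄,
      WeierstrassCurve.b₆, WeierstrassCurve.b₈, shortCurve]
    ring
  rw [this]
  exact mul_ne_zero (by norm_num) hE

/-- Outside of an exceptional set, every rational point `Q₀` with `nQ₀ = σ(P)` is the specialization
of a point `Q` with `nQ = P`. -/
lemma eventually_lift_division (hE : 4 * A ^ 3 + 27 * B ^ 2 ≠ 0) {n : ℕ} (hn : n ≠ 0)
    (P : (shortCurve A B).Point) :
    ∀ᶠ t in hilbertFilter, ∀ h : GoodAt A B t, ∀ Q₀, n • Q₀ = specialize h P →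
      ∃ Q, n • Q = P ∧ specialize h Q = Q₀ := by
  obtain ⟨n, rfl⟩ := Nat.exists_eq_succ_of_ne_zero hn
  obtain ⟨f, hf, hdiv⟩ := exists_division_polynomial n P
  let g (a : RatFunc ℚ) : (RatFunc ℚ)[X] := X ^ 2 - C (a * a * a + A * a + B)
  have hg (a) : g a ≠ 0 := (monic_X_pow_sub_C _ two_ne_zero).ne_zero
  have hy : ∀ᶠ t in hilbertFilter, ∀ a ∈ f.roots.toFinset, ∀ f₀ : (regularRing t)[X],
      f₀.map (regularRing t).subtype = g a → ∀ y, (f₀.map (regularEval t)).eval y = 0 →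
        ∃ b, HasValueAt t b y ∧ (g a).eval b = 0 :=
    (Filter.eventually_all_finset _).mpr fun a _ => eventually_exists_root (hg a)
  -- The roots of f include spurious ones, for instance those from -P. There are only finitely many
  -- candidates Q, and for each one with (n + 1)Q ≠ P the difference stays nonzero outside a finite
  -- set.
  have hsep : ∀ᶠ t in hilbertFilter, ∀ a ∈ f.roots.toFinset, ∀ b ∈ (g a).roots.toFinset,
      ∀ hab : (shortCurve A B).Nonsingular a b, (n + 1) • Point.some a b hab - P ≠ 0 →
        ∀ h : GoodAt A B t, specialize h ((n + 1) • Point.some a b hab - P) ≠ 0 := by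
    refine (Filter.eventually_all_finset _).mpr fun a _ =>
      (Filter.eventually_all_finset _).mpr fun b _ => ?_
    by_cases hab : (shortCurve A B).Nonsingular a b
    · by_cases h0 : (n + 1) • Point.some a b hab - P = 0
      · exact .of_forall fun t _ h1 => absurd h0 h1
      · filter_upwards [eventually_specialize_ne_zero h0] with t ht _ _ using ht
    · exact .of_forall fun t h => absurd h hab
  have hP : ∀ᶠ t in hilbertFilter, ∀ h : GoodAt A B t, specialize h P = 0 → P = 0 := by
    by_cases hP : P = 0
    · exact .of_forall fun _ _ _ => hP
    · filter_upwards [eventually_specialize_ne_zero hP] with t ht h h0 using absurd h0 (ht h)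
  filter_upwards [hdiv, eventually_exists_root hf, hy, hsep, hP] with t hdiv hx hy hsep hP h Q₀ hQ₀
  match Q₀ with
  | .zero =>
    refine ⟨0, ?_, rfl⟩
    rw [← Point.zero_def, nsmul_zero] at hQ₀
    rw [nsmul_zero, hP h hQ₀.symm]
  | .some x y hxy =>
    obtain ⟨f₀, hf₀, hroot⟩ := hdiv h
    obtain ⟨a, ha, hfa⟩ := hx f₀ hf₀ x (hroot x y hxy hQ₀)
    have hmem : a ∈ f.roots.toFinset := by simpa [hf] using hfa
    let c : regularRing t := ⟨a, ha.1⟩ * ⟨a, ha.1⟩ * ⟨a, ha.1⟩ + ⟨A, h.1⟩ * ⟨a, ha.1⟩ + ⟨B, h.2⟩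
    obtain ⟨b, hb, hgb⟩ := hy a hmem (X ^ 2 - C c) (by simp [g, c]) y (by
      have hc : regularEval t c = x * x * x + valueAt t A * x + valueAt t B := by
        rw [← ha.2]
        simp only [c, map_add, map_mul]
        rfl
      have := (shortCurve_equation_iff ..).mp hxy.1
      simp only [Polynomial.map_sub, Polynomial.map_pow, map_X, map_C, eval_sub, eval_pow, eval_X,
        eval_C, hc]
      linear_combination this)
    have hab : (shortCurve A B).Nonsingular a b := by
      apply ratFunc_nonsingular hE
      rw [shortCurve_equation_iff]
      simp only [g, eval_sub, eval_pow, eval_X, eval_C] at hgb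
      linear_combination hgb
    obtain ⟨_, e⟩ := h.specialize_some hab ha hb
    refine ⟨.some a b hab, ?_, e⟩
    by_contra hne
    refine hsep a hmem b (by simpa [hg] using hgb) hab (sub_ne_zero.mpr hne) h ?_
    change h.specializeHom _ = 0
    rw [map_sub, map_nsmul, sub_eq_zero]
    exact (congrArg ((n + 1) • ·) e).trans hQ₀

end Lifting

/-! ### Descent in finitely generated abelian groups. -/

section Descent

variable {M N : Type*} [AddCommGroup M] [AddCommGroup N]

/-- If `φ : M → N` detects divisibility by `n`, every `n`-torsion element of `N` lifts to an
`n`-torsion element of `M`, and `φ` kills no nonzero torsion element, then `φ` is injective. -/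
lemma injective_of_descent [AddGroup.FG M] {n : ℕ} (hn : 2 ≤ n) (φ : M →+ N)
    (hdiv : ∀ a, (∃ b, n • b = φ a) → ∃ c, n • c = a)
    (htors : ∀ b, n • b = 0 → ∃ a, n • a = 0 ∧ φ a = b)
    (hinj : ∀ a, IsOfFinAddOrder a → φ a = 0 → a = 0) : Function.Injective φ := by
  have : Module.Finite ℤ M := Module.Finite.iff_addGroup_fg.mpr inferInstance
  let K : Submodule ℤ M := LinearMap.ker φ.toIntLinearMap
  have hK : K ≤ Ideal.span {(n : ℤ)} • K := by
    intro a ha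
    replace ha : φ a = 0 := ha
    obtain ⟨c, rfl⟩ := hdiv a ⟨0, by rw [ha, nsmul_zero]⟩
    obtain ⟨z, hz, hzc⟩ := htors (φ c) (by rw [← map_nsmul, ha])
    have : n • c = (n : ℤ) • (c - z) := by rw [natCast_zsmul, nsmul_sub, hz, sub_zero]
    rw [this]
    refine Submodule.smul_mem_smul (Ideal.mem_span_singleton_self _) ?_
    change φ (c - z) = 0
    rw [map_sub, hzc, sub_self]
  -- Nakayama gives r ≡ 1 mod n with rK = 0; r is nonzero because n ≥ 2.
  obtain ⟨r, hr, hrK⟩ := Submodule.exists_sub_one_mem_and_smul_eq_zero_of_fg_of_le_smul _ K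
    (IsNoetherian.noetherian K) hK
  have hr0 : r ≠ 0 := by
    rintro rfl
    rw [Ideal.mem_span_singleton] at hr
    have := Int.le_of_dvd one_pos (by simpa using hr)
    omega
  refine (injective_iff_map_eq_zero φ).mpr fun a ha => hinj a ?_ ha
  exact isOfFinAddOrder_iff_zsmul_eq_zero.mpr ⟨r, hr0, hrK a ha⟩

lemma finite_quotient_multiplesOf [AddGroup.FG M] {n : ℕ} (hn : n ≠ 0) :
    Finite (M ⧸ multiplesOf n M) := by
  refine AddCommGroup.finite_of_fg_isAddTorsion _ fun q => ?_
  obtain ⟨a, rfl⟩ := QuotientAddGroup.mk_surjective q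
  refine isOfFinAddOrder_iff_nsmul_eq_zero.mpr ⟨n, Nat.pos_of_ne_zero hn, ?_⟩
  rw [← QuotientAddGroup.mk_nsmul, QuotientAddGroup.eq_zero_iff]
  exact ⟨a, rfl⟩

lemma finite_setOf_isOfFinAddOrder [AddGroup.FG M] : {a : M | IsOfFinAddOrder a}.Finite := by
  have : Module.Finite ℤ M := Module.Finite.iff_addGroup_fg.mpr inferInstance
  have : Finite (Submodule.torsion ℤ M) := Module.finite_of_fg_torsion _ Submodule.torsion_isTorsion
  refine Set.Finite.subset (Set.toFinite (Submodule.torsion ℤ M : Set M)) fun a ha => ?_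
  obtain ⟨r, hr, hra⟩ := isOfFinAddOrder_iff_zsmul_eq_zero.mp ha
  exact ⟨⟨r, mem_nonZeroDivisors_of_ne_zero hr⟩, hra⟩

lemma mk_multiplesOf_eq_zero_iff {n : ℕ} {a : M} :
    (a : M ⧸ multiplesOf n M) = 0 ↔ ∃ b, n • b = a :=
  QuotientAddGroup.eq_zero_iff a

end Descent

end

/-! ### Injectivity of specialization on M. -/

theorem mainTheorem1 (A B : RatFunc ℚ)
    (hE : 4 * A ^ 3 + 27 * B ^ 2 ≠ 0)
    (hnonconst : ¬ ∃ a b : ℚ, A = RatFunc.C a ∧ B = RatFunc.C b)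
    (n : ℕ) (hn : 2 ≤ n)
    (M : AddSubgroup (shortCurve A B).Point)
    (hrank : 1 ≤ Module.finrank ℤ M)
    (hM : DescentConditions n M.subtype) :
    ∃ S H : Set ℚ, IsHilbertSet H ∧ (symmDiff S H).Finite ∧
      ∀ t₀ ∈ S, ∃ h : GoodAt A B t₀,
        Function.Injective (fun P : M => specialize h (P : (shortCurve A B).Point)) := by
  have hn0 : n ≠ 0 := by omega
  have := hM.fg
  have := finite_quotient_multiplesOf (M := M) hn0
  -- The exceptional set of the lifting depends on the point, so it is applied only to one
  -- representative of each of the finitely many classes of M/nM.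
  have hrep : ∀ᶠ t in hilbertFilter, ∀ q : M ⧸ multiplesOf n M, ∀ h : GoodAt A B t, ∀ Q₀,
      n • Q₀ = specialize h (q.out : M) →
        ∃ Q : (shortCurve A B).Point, n • Q = (q.out : M) ∧ specialize h Q = Q₀ :=
    Filter.eventually_all.mpr fun q => eventually_lift_division hE hn0 _
  have htors : ∀ᶠ t in hilbertFilter, ∀ a ∈ {a : M | IsOfFinAddOrder a}, ∀ h : GoodAt A B t,
      specialize h (a : (shortCurve A B).Point) = 0 → a = 0 := by
    refine (Filter.eventually_all_finite finite_setOf_isOfFinAddOrder).mpr fun a _ => ?_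
    by_cases ha : a = 0
    · exact .of_forall fun _ _ _ => ha
    · filter_upwards [eventually_specialize_ne_zero (P := (a : (shortCurve A B).Point))
        (by simpa using ha)] with t ht h h0 using absurd h0 (ht h)
  have hmem : {t | ∃ h : GoodAt A B t,
      Function.Injective (fun P : M => specialize h (P : (shortCurve A B).Point))} ∈
        hilbertFilter := by
    filter_upwards [eventually_goodAt hE, hrep, htors, eventually_lift_division hE hn0 0]
      with t h hrep htors hzero
    refine ⟨h, injective_of_descent hn (h.specializeHom.comp M.subtype) ?_ ?_
      fun a ha => htors a ha h⟩
    · rintro a ⟨b, hb⟩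
      rw [← mk_multiplesOf_eq_zero_iff]
      set q : M ⧸ multiplesOf n M := QuotientAddGroup.mk a with hq
      obtain ⟨c, hc⟩ : ∃ c, n • c = q.out - a := by
        rw [← mk_multiplesOf_eq_zero_iff, QuotientAddGroup.mk_sub, QuotientAddGroup.out_eq', ← hq,
          sub_self]
      -- As the representative is a + nc and σ(a) = nb, the point b + σ(c) is an n-th part of its
      -- specialization.
      obtain ⟨Q, hQ, -⟩ := hrep q h (b + h.specializeHom c) (by
        rw [nsmul_add, hb, ← map_nsmul]
        change h.specializeHom _ + _ = h.specializeHom _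
        rw [← map_add, ← AddSubgroup.coe_nsmul, hc]
        simp)
      apply hM.injective_mod
      rw [map_zero, ← QuotientAddGroup.out_eq' q]
      exact mk_multiplesOf_eq_zero_iff.mpr ⟨Q, hQ⟩
    · intro b hb
      obtain ⟨Q, hQ, hQb⟩ := hzero h b hb
      obtain ⟨a, ha, rfl⟩ := hM.bijOn_torsion.surjOn hQ
      exact ⟨a, ha, hQb⟩
  exact exists_isHilbertSet_of_mem_hilbertFilter hmem
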